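/- **Setting.** Graphs $G=(A,X)$ are finite, simple and undirected, on the node set $[n]$, with node features $x_i\in\mathbb R^d$ ($n$ varies, $d$ is fixed). A node-based policy $\pi$ sends $G$ to a bag $(G^v)_{v\in[n]}$ of subgraphs of $G$, stored as adjacencies $\sim_v$ and features $x^v_i$, $i\in[n]$: all $n$ rows are kept, nodes outside $G^v$ are isolated rows of $\sim_v$ and keep their features. The class $\Pi$ consists of node deletion ND ($G^v$ is $G$ without $v$), node marking NM ($G^v=G$, with one more feature channel equal to $1$ at $v$ and $0$ elsewhere), ego-networks EGO$(h)$ ($G^v$ is induced by the nodes at distance $\le h$ from $v$) and marked ego-networks EGO+$(h)$ (the same, marked as in NM), for all $h>0$. A *ReIGN(2) layer* keeps all adjacencies and replaces $x^i_i$ by a sum of linear images of $$x^i_i,\quad \square_j x^j_j,\quad \square_{j\ne i}x^i_j,\quad \square_{h\neq i}x^h_i,\quad \square_{h\ne j}x^h_j$$ plus a bias, and $x^k_i$ ($k\ne i$) by a sum of linear images of $$x^k_i,\ x^i_k,\ \square_{h\ne j}x^h_j,\ \square_{h\ne i}x^h_i,\ \square_{j\ne k}x^k_j,\ \square_{j\neq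 i}x^i_j,\ \square_{h\ne k}x^h_k,\ x^k_k,\ x^i_i,\ \square_j x^j_j$$ plus a bias. The linear maps and biases do not depend on $i,k,n,G$. Each $\square$ is expanded into sums, each with its own linear map: the global sum over the displayed range, the sum over the neighbours of $i$ for $\sim_k$ ($\sim_i$ in the update of $x^i_i$), and the sum over the neighbours of $i$ in $G$. The double term $\square_{h\neq j}x^h_j$ is expanded in both indices: $h$ runs over all nodes, or over the neighbours of $i$ for $\sim_k$ (resp. $\sim_i$), or over the neighbours of $i$ in $G$; and $j$ runs over all nodes $\ne h$, or over the neighbours for $\sim_h$, or over the neighbours in $G$, of $h$ in the update of $x^i_i$ and of $i$ in the update of $x^k_i$. A *ReIGN(2) model* is $\mathcal R=\mu\circ\rho\circ\mathcal S\circ\pi$, where $\mathcal S=L^{(T)}\circ\sigma\circ\cdots\circ\sigma\circ L^{(1)}$, $T\ge 1$, alternates ReIGN(2) layers and arbitrary pointwise nonlinearities, $\rho$ maps a graph with its bag to a vector, and $\mu$ is a multi-layer perceptron with an arbitrary activation. A *3-IGN* is $m\circ h\circ L^{(T)}\circ\mathrm{ReLU}\circ\cdots\circ\mathrm{ReLU}\circ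 L^{(1)}$, where the $L$'s are $S_n$-equivariant linear layers with bias between tensors of order $\le3$ (combinations, with parameters independent of $n$, of the equality-pattern basis), $h$ is an invariant linear layer and $m$ a ReLU perceptron. The function $\rho$ is *3-IGN-computable* if for any two inputs there is a 3-IGN agreeing with $\rho$ on both (for instance, if one 3-IGN implements $\rho$ on all inputs). The input $(G,(G^v)_v)$ is given to the 3-IGN as the tensor whose entry $(k,i,j)$ holds the adjacencies of $i,j$ in $G^k$ and in $G$ and, if $i=j$, the membership of $i$ in $G^k$ and the vectors $x_i$ and $x^k_i$. *3-WL* colours each triple of nodes first by its isomorphism type (equalities, adjacencies and features of its entries), and then repeatedly by its previous colour together with, for each position $p\in\{1,2,3\}$, the multiset of the previous colours of the triples obtained by replacing the $p$-th entry by any node. It distinguishes two graphs if after some round their multisets of colours of triples differ. **Corollary.** Let $\mathcal R=\mu\circ\rho\circ\mathcal S\circ\pi$ be a ReIGN(2) model with $\pi\in\Pi$ and $\rho$ 3-IGN-computable. If $\mathcal R(G_1)\ne\mathcal R(G_2)$ for two graphs $G_1,G_2$, then 3-WL distinguishes $G_1$ and $G_2$. -/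

import Mathlib

namespace SubgraphGNN

/-! Node-attributed graphs, bags of subgraphs and node-based selection policies. -/

/-- A finite simple undirected graph on the node set `Fin n`, each node carrying a feature vector
in `ℝ^d`. -/
structure AttrGraph (n d : ℕ) where
  graph : SimpleGraph (Fin n)
  feat : Fin n → Fin d → ℝ

/-- A subgraph of `G` together with a feature matrix. As in the tensors `(𝒜, 𝒳)` of
size `n × n × n` and `n × n × d`, the matrix has one row for each of the `n` nodes of `G`; a node
outside the subgraph is an isolated row. -/
structure AttrSubgraph {n d₀ : ℕ} (G : AttrGraph n d₀) (d : ℕ) where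
  sub : G.graph.Subgraph
  feat : Fin n → Fin d → ℝ

/-- A node-based bag: one subgraph for every root node. `(B k).feat i` is `x^k_i`, the
representation of node `i` in subgraph `k`. -/
abbrev Bag {n d₀ : ℕ} (G : AttrGraph n d₀) (d : ℕ) : Type := Fin n → AttrSubgraph G d

/-- A node-based subgraph selection policy, given by its selection function `(G, v) ↦ G^v`. -/
structure NodePolicy (d₀ d : ℕ) where
  select : ∀ {n : ℕ} (G : AttrGraph n d₀), Fin n → AttrSubgraph G d

/-- The bag `π(G) = {f(G, v)}_v`. -/
def NodePolicy.bag {d₀ d : ℕ} (π : NodePolicy d₀ d) {n : ℕ} (G : AttrGraph n d₀) : Bag G d :=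
  fun v => π.select G v

open Classical in
/-- The node features with one more channel, equal to `1` at the root `v` and `0` elsewhere. -/
noncomputable def markedFeat {n d : ℕ} (G : AttrGraph n d) (v : Fin n) :
    Fin n → Fin (d + 1) → ℝ :=
  fun i => Fin.snoc (α := fun _ => ℝ) (G.feat i) (if i = v then 1 else 0)

/-- The subgraph of `G` induced by the nodes at distance at most `h` from `v`. -/
def egoNet {n d : ℕ} (G : AttrGraph n d) (h : ℕ) (v : Fin n) : G.graph.Subgraph :=
  (⊤ : G.graph.Subgraph).induce {w | G.graph.edist v w ≤ (h : ℕ∞)}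

/-- Node deletion (ND). -/
def nodeDeletion (d : ℕ) : NodePolicy d d where
  select G v := ⟨(⊤ : G.graph.Subgraph).deleteVerts {v}, G.feat⟩

/-- Node marking (NM). -/
noncomputable def nodeMarking (d : ℕ) : NodePolicy d (d + 1) where
  select G v := ⟨⊤, markedFeat G v⟩

/-- Ego-networks of depth `h` (EGO(h)). -/
def egoNets (d h : ℕ) : NodePolicy d d where
  select G v := ⟨egoNet G h v, G.feat⟩

/-- Marked ego-networks of depth `h` (EGO+(h)). -/
noncomputable def markedEgoNets (d h : ℕ) : NodePolicy d (d + 1) where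
  select G v := ⟨egoNet G h v, markedFeat G v⟩

/-- Membership in the class `Π = {ND, NM, EGO(h), EGO+(h) | h > 0}`. -/
inductive KnownPolicy (d : ℕ) : ∀ {d₁ : ℕ}, NodePolicy d d₁ → Prop
  | nd : KnownPolicy d (nodeDeletion d)
  | nm : KnownPolicy d (nodeMarking d)
  | ego (h : ℕ) (hpos : 0 < h) : KnownPolicy d (egoNets d h)
  | egoPlus (h : ℕ) (hpos : 0 < h) : KnownPolicy d (markedEgoNets d h)

/-! Multi-layer perceptrons. -/

/-- The parameters of a multi-layer perceptron `ℝ^a → ℝ^b`. -/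
inductive MLP : ℕ → ℕ → Type
  | last {a b : ℕ} (W : Matrix (Fin b) (Fin a) ℝ) (c : Fin b → ℝ) : MLP a b
  | cons {a b e : ℕ} (W : Matrix (Fin b) (Fin a) ℝ) (c : Fin b → ℝ) (rest : MLP b e) : MLP a e

/-- Evaluation of a perceptron with pointwise activation `act` after every hidden layer. -/
def MLP.eval (act : ℝ → ℝ) : {a b : ℕ} → MLP a b → (Fin a → ℝ) → (Fin b → ℝ)
  | _, _, .last W c, x => W.mulVec x + c
  | _, _, .cons W c rest, x => rest.eval act (fun l => act ((W.mulVec x + c) l))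

/-! ReIGN(2) layers and stacks. -/

/-- The three expansions of an aggregation: global, over the neighbours in the subgraph at hand,
over the neighbours in the original graph. -/
inductive Locality
  | all
  | sub
  | orig
  deriving DecidableEq

instance : Fintype Locality where
  elems := {.all, .sub, .orig}
  complete := fun s => by cases s <;> simp

open Classical in
/-- The nodes over which an aggregation extends: all nodes but those in `excl`, or the neighbours
of `i` in subgraph `k`, or the neighbours of `i` in the original graph. -/
noncomputable def scope {n d₀ d : ℕ} {G : AttrGraph n d₀} (B : Bag G d) (k i : Fin n)
    (excl : Finset (Fin n)) : Locality → Finset (Fin n)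
  | .all => Finset.univ \ excl
  | .sub => Finset.univ.filter (fun j => (B k).sub.Adj i j)
  | .orig => Finset.univ.filter (fun j => G.graph.Adj i j)

/-- The parameters of a ReIGN(2) layer: one linear map for each term of the on-diagonal update and
of the off-diagonal update (one for each expansion of an aggregated term), and two biases. -/
structure ReIGNLayer (d d₁ : ℕ) where
  onSelf : Matrix (Fin d₁) (Fin d) ℝ
  on1 : Locality → Matrix (Fin d₁) (Fin d) ℝ
  on2 : Locality → Matrix (Fin d₁) (Fin d) ℝ
  on3 : Locality → Matrix (Fin d₁) (Fin d) ℝ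
  on4 : Locality → Locality → Matrix (Fin d₁) (Fin d) ℝ
  onBias : Fin d₁ → ℝ
  offSelf : Matrix (Fin d₁) (Fin d) ℝ
  offTranspose : Matrix (Fin d₁) (Fin d) ℝ
  off1 : Locality → Locality → Matrix (Fin d₁) (Fin d) ℝ
  off2 : Locality → Matrix (Fin d₁) (Fin d) ℝ
  off3 : Locality → Matrix (Fin d₁) (Fin d) ℝ
  off4 : Locality → Matrix (Fin d₁) (Fin d) ℝ
  off5 : Locality → Matrix (Fin d₁) (Fin d) ℝ
  off6 : Locality → Matrix (Fin d₁) (Fin d) ℝ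
  offSubRoot : Matrix (Fin d₁) (Fin d) ℝ
  offNodeRoot : Matrix (Fin d₁) (Fin d) ℝ
  offBias : Fin d₁ → ℝ

/-- The update of the root representation `x^i_i`. -/
noncomputable def ReIGNLayer.onUpdate {d d₁ : ℕ} (L : ReIGNLayer d d₁) {n d₀ : ℕ}
    {G : AttrGraph n d₀} (B : Bag G d) (i : Fin n) : Fin d₁ → ℝ :=
  L.onSelf.mulVec ((B i).feat i)
  + ∑ s, (L.on1 s).mulVec (∑ j ∈ scope B i i ∅ s, (B j).feat j)
  + ∑ s, (L.on2 s).mulVec (∑ j ∈ scope B i i {i} s, (B i).feat j)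
  + ∑ s, (L.on3 s).mulVec (∑ h ∈ scope B i i {i} s, (B h).feat i)
  + ∑ s, ∑ r, (L.on4 s r).mulVec
      (∑ h ∈ scope B i i ∅ s, ∑ j ∈ scope B h h {h} r, (B h).feat j)
  + L.onBias

/-- The update of the non-root representation `x^k_i`, `i ≠ k`. -/
noncomputable def ReIGNLayer.offUpdate {d d₁ : ℕ} (L : ReIGNLayer d d₁) {n d₀ : ℕ}
    {G : AttrGraph n d₀} (B : Bag G d) (k i : Fin n) : Fin d₁ → ℝ :=
  L.offSelf.mulVec ((B k).feat i)
  + L.offTranspose.mulVec ((B i).feat k)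
  + ∑ s, ∑ r, (L.off1 s r).mulVec
      (∑ h ∈ scope B k i ∅ s, ∑ j ∈ scope B h i {h} r, (B h).feat j)
  + ∑ s, (L.off2 s).mulVec (∑ h ∈ scope B k i {i} s, (B h).feat i)
  + ∑ s, (L.off3 s).mulVec (∑ j ∈ scope B k i {k} s, (B k).feat j)
  + ∑ s, (L.off4 s).mulVec (∑ h ∈ scope B k i {i} s, (B i).feat h)
  + ∑ s, (L.off5 s).mulVec (∑ h ∈ scope B k i {k} s, (B h).feat k)
  + ∑ s, (L.off6 s).mulVec (∑ j ∈ scope B k i ∅ s, (B j).feat j)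
  + L.offSubRoot.mulVec ((B k).feat k)
  + L.offNodeRoot.mulVec ((B i).feat i)
  + L.offBias

/-- A layer changes the node representations and keeps the connectivity of every subgraph. -/
noncomputable def ReIGNLayer.apply {d d₁ : ℕ} (L : ReIGNLayer d d₁) {n d₀ : ℕ}
    {G : AttrGraph n d₀} (B : Bag G d) : Bag G d₁ :=
  fun k => ⟨(B k).sub, fun i => if i = k then L.onUpdate B i else L.offUpdate B k i⟩

/-- Pointwise application of `σ` to all node representations. -/
def Bag.mapFeat (σ : ℝ → ℝ) {n d₀ d : ℕ} {G : AttrGraph n d₀} (B : Bag G d) : Bag G d :=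
  fun k => ⟨(B k).sub, fun i l => σ ((B k).feat i l)⟩

/-- A stack `L^(T) ∘ σ ∘ ⋯ ∘ σ ∘ L^(1)`, `T ≥ 1`, of ReIGN(2) layers, listed from the first one
on, with arbitrary pointwise nonlinearities. -/
inductive ReIGNStack : ℕ → ℕ → Type
  | last {d d₁ : ℕ} (L : ReIGNLayer d d₁) : ReIGNStack d d₁
  | cons {d d₁ d₂ : ℕ} (L : ReIGNLayer d d₁) (σ : ℝ → ℝ) (rest : ReIGNStack d₁ d₂) :
      ReIGNStack d d₂

/-- The map on bags computed by a stack. -/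
noncomputable def ReIGNStack.eval {n d₀ : ℕ} {G : AttrGraph n d₀} :
    {d d₁ : ℕ} → ReIGNStack d d₁ → Bag G d → Bag G d₁
  | _, _, .last L, B => L.apply B
  | _, _, .cons L σ rest, B => rest.eval ((L.apply B).mapFeat σ)

/-- A pooling function `ρ : (G, B) ↦ x_G`. -/
abbrev Pooling (d₀ d e : ℕ) : Type :=
  ∀ ⦃n : ℕ⦄ (G : AttrGraph n d₀), Bag G d → Fin e → ℝ

/-- The ReIGN(2) model `μ ∘ ρ ∘ S ∘ π`, where the perceptron `μ` has activation `act`. -/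
noncomputable def reignModel {d d₁ d₂ e out : ℕ} (π : NodePolicy d d₁) (S : ReIGNStack d₁ d₂)
    (ρ : Pooling d d₂ e) (act : ℝ → ℝ) (μ : MLP e out) {n : ℕ} (G : AttrGraph n d) :
    Fin out → ℝ :=
  μ.eval act (ρ G (S.eval (π.bag G)))

/-! Invariant graph networks of order at most three. -/

/-- A `k`-order tensor over `[n]` with `d` channels. -/
abbrev Tensor (n k d : ℕ) : Type := (Fin k → Fin n) → Fin d → ℝ

/-- The parameters of a linear equivariant layer from tensors of order `k` to tensors of order
`k₁`: one linear map on channels for each equality pattern on `k + k₁` indices, that is, for each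
element of the basis of the space of equivariant linear maps, and one bias for each equality
pattern on the output indices. They do not depend on `n`. -/
structure IGNLayer (k k₁ d d₁ : ℕ) where
  weight : Setoid (Fin k ⊕ Fin k₁) → Matrix (Fin d₁) (Fin d) ℝ
  bias : Setoid (Fin k₁) → Fin d₁ → ℝ

/-- The equivariant affine map given by the parameters. -/
noncomputable def IGNLayer.apply {k k₁ d d₁ : ℕ} (L : IGNLayer k k₁ d d₁) {n : ℕ}
    (Y : Tensor n k d) : Tensor n k₁ d₁ :=
  fun b => ∑ a : Fin k → Fin n, (L.weight (Setoid.ker (Sum.elim a b))).mulVec (Y a)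
    + L.bias (Setoid.ker b)

/-- The ReLU nonlinearity. -/
noncomputable def relu (x : ℝ) : ℝ := max x 0

/-- A stack of equivariant linear layers, `T ≥ 1`, between tensors of order at most three. -/
inductive IGNStack : ℕ → ℕ → ℕ → ℕ → Type
  | last {k k₁ d d₁ : ℕ} (hk : k ≤ 3) (hk₁ : k₁ ≤ 3) (L : IGNLayer k k₁ d d₁) :
      IGNStack k d k₁ d₁
  | cons {k k₁ k₂ d d₁ d₂ : ℕ} (hk : k ≤ 3) (L : IGNLayer k k₁ d d₁)
      (rest : IGNStack k₁ d₁ k₂ d₂) : IGNStack k d k₂ d₂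

/-- The map `L^(T) ∘ σ ∘ ⋯ ∘ σ ∘ L^(1)` with ReLU nonlinearities. -/
noncomputable def IGNStack.eval {n : ℕ} :
    {k d k₁ d₁ : ℕ} → IGNStack k d k₁ d₁ → Tensor n k d → Tensor n k₁ d₁
  | _, _, _, _, .last _ _ L, Y => L.apply Y
  | _, _, _, _, .cons _ L rest, Y => rest.eval (fun b l => relu (L.apply Y b l))

/-- A 3-IGN `m ∘ h ∘ I` on third order tensors with `d` channels: `I` is a stack of equivariant
layers, `h` an invariant linear layer and `m` a ReLU perceptron. -/
structure IGN3 (d out : ℕ) where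
  {k d₁ e : ℕ}
  stack : IGNStack 3 d k d₁
  pool : IGNLayer k 0 d₁ e
  mlp : MLP e out

/-- The output of a 3-IGN. -/
noncomputable def IGN3.eval {d out : ℕ} (M : IGN3 d out) {n : ℕ} (Y : Tensor n 3 d) :
    Fin out → ℝ :=
  M.mlp.eval relu (M.pool.apply (M.stack.eval Y) Fin.elim0)

open Classical in
/-- A bag, with the graph it comes from, as a third order tensor. The entry at `(k, i, j)`, `i ≠ j`,
holds the adjacency of `i` and `j` in subgraph `k` and in the original graph; the entry at
`(k, i, i)` holds the membership of `i` in subgraph `k`, the original features of `i` and its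
representation `x^k_i`. -/
noncomputable def bagTensor {n d₀ d : ℕ} (G : AttrGraph n d₀) (B : Bag G d) :
    Tensor n 3 (3 + (d₀ + d)) :=
  fun a =>
    let k := a 0
    let i := a 1
    let j := a 2
    Fin.append
      ![if (B k).sub.Adj i j then 1 else 0,
        if G.graph.Adj i j then 1 else 0,
        if i = j ∧ i ∈ (B k).sub.verts then 1 else 0]
      (if i = j then Fin.append (G.feat i) ((B k).feat i) else 0)

/-- A 3-IGN implements a pooling function at the bag `B` of the graph `G`. -/
def IGN3.ImplementsAt {d₀ d e : ℕ} (M : IGN3 (3 + (d₀ + d)) e) (ρ : Pooling d₀ d e) {n : ℕ}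
    (G : AttrGraph n d₀) (B : Bag G d) : Prop :=
  M.eval (bagTensor G B) = ρ G B

/-- `ρ` is 3-IGN-computable: on any two inputs it is implemented by a 3-IGN. This forces `ρ` to be
invariant under permutations of the nodes. -/
def IsIGN3Computable {d₀ d e : ℕ} (ρ : Pooling d₀ d e) : Prop :=
  ∀ ⦃n₁ n₂ : ℕ⦄ (G₁ : AttrGraph n₁ d₀) (B₁ : Bag G₁ d) (G₂ : AttrGraph n₂ d₀) (B₂ : Bag G₂ d),
    ∃ M : IGN3 (3 + (d₀ + d)) e, M.ImplementsAt ρ G₁ B₁ ∧ M.ImplementsAt ρ G₂ B₂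

/-- In particular `ρ` is 3-IGN-computable if a single 3-IGN implements it on all inputs. -/
theorem IsIGN3Computable.of_implements {d₀ d e : ℕ} (ρ : Pooling d₀ d e)
    (M : IGN3 (3 + (d₀ + d)) e)
    (hM : ∀ {n : ℕ} (G : AttrGraph n d₀) (B : Bag G d), M.ImplementsAt ρ G B) :
    IsIGN3Computable ρ :=
  fun _ _ G₁ B₁ G₂ B₂ => ⟨M, hM G₁ B₁, hM G₂ B₂⟩

/-! The `k`-dimensional Weisfeiler-Leman test. -/

/-- The colours of `k`-WL after `t` rounds. An initial colour is the isomorphism type of an ordered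
`k`-tuple: which entries are equal, which are adjacent, and their features. A later colour consists
of the previous one and, for each of the `k` positions, a multiset of previous colours. -/
def WLColor (k d : ℕ) : ℕ → Type
  | 0 => (Fin k → Fin k → Prop) × (Fin k → Fin k → Prop) × (Fin k → Fin d → ℝ)
  | t + 1 => WLColor k d t × (Fin k → Multiset (WLColor k d t))

/-- The colour of a `k`-tuple after `t` rounds of `k`-WL. -/
def wlColor (k : ℕ) {n d : ℕ} (G : AttrGraph n d) : (t : ℕ) → (Fin k → Fin n) → WLColor k d t
  | 0, u => (fun p q => u p = u q, fun p q => G.graph.Adj (u p) (u q), fun p => G.feat (u p))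
  | t + 1, u => (wlColor k G t u, fun p =>
      (Finset.univ : Finset (Fin n)).val.map (fun w => wlColor k G t (Function.update u p w)))

/-- The multiset of the colours of all `k`-tuples after `t` rounds. -/
def wlHistogram (k : ℕ) {n d : ℕ} (G : AttrGraph n d) (t : ℕ) : Multiset (WLColor k d t) :=
  (Finset.univ : Finset (Fin k → Fin n)).val.map (wlColor k G t)

/-- `k`-WL distinguishes the two graphs. -/
def WLDistinguishes (k : ℕ) {n₁ n₂ d : ℕ} (G₁ : AttrGraph n₁ d) (G₂ : AttrGraph n₂ d) : Prop :=
  ∃ t : ℕ, wlHistogram k G₁ t ≠ wlHistogram k G₂ t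

end SubgraphGNN

open SubgraphGNN

/-! Suppose 3-WL does not distinguish the graphs. Call two triples similar if no round separates
them (`WLSim`). Similarity is a winning position of the bijective game with three pebbles: any
pebble may be moved along some bijection of the nodes (`WLSim.exists_equiv`), and pebbles may be
permuted or copied (`WLSim.comp`). So any quantity computed while remembering at most three nodes at
a time agrees on similar triples.

Policies and ReIGN(2) layers are of this kind: a representation depends on root and node, which
leaves one pebble for a summation index. Nested sums still fit, because a node no longer needed
frees its pebble. Hence similarity of bags (`BagSim`) passes through the stack.

For a 3-IGN, an equivariant layer seems to compare up to six indices. But its weights see input and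
output tuples only through their own equality patterns and their mutual coincidences.
Inclusion-exclusion over coincidences reduces its sums to sums in which some input coordinates are
copied from the output tuple and the others are free; the free ones are summed by pebble moves
(`TupleSim.apply`).

The invariant output has no indices left, so a single pair of similar triples forces equal outputs.
Equal histograms provide such a pair, unless the graphs are empty. -/

namespace SubgraphGNN

/-! Tuples which `k`-WL does not tell apart. -/

/-- Two functions with the same multiset of values agree up to a bijection of their domains. -/
theorem exists_equiv_of_map_univ_eq {α β γ : Type*} [Fintype α] [Fintype β] {f : α → γ}
    {g : β → γ} (h : (Finset.univ : Finset α).val.map f = (Finset.univ : Finset β).val.map g) :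
    ∃ φ : α ≃ β, ∀ a, g (φ a) = f a := by
  classical
  have hc : ∀ c, Nonempty ({a // f a = c} ≃ {b // g b = c}) := fun c => by
    have h1 := congrArg (Multiset.count c) h
    rw [Multiset.count_map, Multiset.count_map] at h1
    refine Fintype.card_eq.mp ?_
    rw [Fintype.card_subtype, Fintype.card_subtype, Finset.card_def, Finset.card_def,
      Finset.filter_val, Finset.filter_val]
    simpa only [eq_comm] using h1
  exact ⟨Equiv.ofFiberEquiv fun c => (hc c).some, fun a => Equiv.ofFiberEquiv_map _ a⟩

theorem map_univ_eq_of_equiv {α β γ : Type*} [Fintype α] [Fintype β] {f : α → γ} {g : β → γ}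
    (φ : α ≃ β) (h : ∀ a, g (φ a) = f a) :
    (Finset.univ : Finset α).val.map f = (Finset.univ : Finset β).val.map g := by
  rw [← Multiset.map_univ_val_equiv φ, Multiset.map_map]
  exact Multiset.map_congr rfl fun a _ => (h a).symm

section WL

variable {k n d : ℕ} {G₁ G₂ : AttrGraph n d}

theorem wlColor_eq_of_le {u u' : Fin k → Fin n} {s t : ℕ} (hst : s ≤ t)
    (h : wlColor k G₁ t u = wlColor k G₂ t u') : wlColor k G₁ s u = wlColor k G₂ s u' := by
  induction t, hst using Nat.le_induction with
  | base => exact h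
  | succ t _ ih => exact ih (congrArg Prod.fst h)

/-- Equality of the refinement multisets, in game form. The bijection may depend on the round as
well as on the position. -/
theorem wlColor_succ_eq_iff {t : ℕ} {u u' : Fin k → Fin n} :
    wlColor k G₁ (t + 1) u = wlColor k G₂ (t + 1) u' ↔
      wlColor k G₁ t u = wlColor k G₂ t u' ∧ ∀ p, ∃ φ : Fin n ≃ Fin n, ∀ w,
        wlColor k G₂ t (Function.update u' p (φ w)) =
          wlColor k G₁ t (Function.update u p w) := by
  refine ⟨fun h => ⟨congrArg Prod.fst h, fun p => exists_equiv_of_map_univ_eq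
    (f := fun w => wlColor k G₁ t (Function.update u p w))
    (g := fun w => wlColor k G₂ t (Function.update u' p w))
    (congrFun (congrArg Prod.snd h) p)⟩, fun h => Prod.ext h.1 (funext fun p => ?_)⟩
  obtain ⟨φ, hφ⟩ := h.2 p
  exact map_univ_eq_of_equiv (f := fun w => wlColor k G₁ t (Function.update u p w))
    (g := fun w => wlColor k G₂ t (Function.update u' p w)) φ hφ

/-- Refinement treats all positions alike: a move at `p` after permuting is a move at `σ p` before,
so the same bijection serves. -/
theorem wlColor_comp_perm (σ : Equiv.Perm (Fin k)) (t : ℕ) : ∀ {u u' : Fin k → Fin n},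
    wlColor k G₁ t u = wlColor k G₂ t u' →
      wlColor k G₁ t (u ∘ σ) = wlColor k G₂ t (u' ∘ σ) := by
  induction t with
  | zero =>
    intro u u' h
    have h1 := congrArg Prod.fst h
    have h2 := congrArg (fun x => x.2.1) h
    have h3 := congrArg (fun x => x.2.2) h
    refine Prod.ext ?_ (Prod.ext ?_ ?_)
    · funext p q
      exact congrFun (congrFun h1 (σ p)) (σ q)
    · funext p q
      exact congrFun (congrFun h2 (σ p)) (σ q)
    · funext p
      exact congrFun h3 (σ p)
  | succ t ih =>
    intro u u' h
    rw [wlColor_succ_eq_iff] at h ⊢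
    refine ⟨ih h.1, fun p => ?_⟩
    obtain ⟨φ, hφ⟩ := h.2 (σ p)
    refine ⟨φ, fun w => ?_⟩
    have hu : ∀ (v : Fin k → Fin n) (x : Fin n),
        Function.update (v ∘ σ) p x = Function.update v (σ p) x ∘ σ := fun v x =>
      (Function.update_comp_eq_of_injective v σ.injective p x).symm
    rw [hu, hu]
    exact (ih (hφ w).symm).symm

/-- No round of `k`-WL tells the two tuples apart. -/
def WLSim (G₁ G₂ : AttrGraph n d) (u u' : Fin k → Fin n) : Prop :=
  ∀ t, wlColor k G₁ t u = wlColor k G₂ t u'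

namespace WLSim

variable {u u' : Fin k → Fin n}

theorem eq_iff (h : WLSim G₁ G₂ u u') (p q : Fin k) : u p = u q ↔ u' p = u' q :=
  iff_of_eq (congrFun (congrFun (congrArg Prod.fst (h 0)) p) q)

theorem adj_iff (h : WLSim G₁ G₂ u u') (p q : Fin k) :
    G₁.graph.Adj (u p) (u q) ↔ G₂.graph.Adj (u' p) (u' q) :=
  iff_of_eq (congrFun (congrFun (congrArg (fun x => x.2.1) (h 0)) p) q)

theorem feat_eq (h : WLSim G₁ G₂ u u') (p : Fin k) : G₁.feat (u p) = G₂.feat (u' p) :=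
  congrFun (congrArg (fun x => x.2.2) (h 0)) p

/-- One move of the bijective pebble game. -/
theorem exists_equiv (h : WLSim G₁ G₂ u u') (p : Fin k) : ∃ φ : Fin n ≃ Fin n, ∀ w,
    WLSim G₁ G₂ (Function.update u p w) (Function.update u' p (φ w)) := by
  by_contra hne
  simp only [WLSim, not_exists, not_forall] at hne
  choose w t hwt using hne
  -- There are finitely many bijections; if each fails in some round, all have failed by round `T`,
  -- against equality of colours in round `T + 1`.
  let T := Finset.univ.sup t
  obtain ⟨φ, hφ⟩ := (wlColor_succ_eq_iff.mp (h (T + 1))).2 p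
  exact hwt φ (wlColor_eq_of_le (Finset.le_sup (f := t) (Finset.mem_univ φ)) (hφ (w φ)).symm)

/-- Pebble `p` may be put on top of pebble `q`: isomorphism types record equalities, so the
bijection for `p` must send `u q` to `u' q`. -/
theorem update_apply (h : WLSim G₁ G₂ u u') (p q : Fin k) :
    WLSim G₁ G₂ (Function.update u p (u q)) (Function.update u' p (u' q)) := by
  rcases eq_or_ne p q with rfl | hpq
  · simpa using h
  · obtain ⟨φ, hφ⟩ := h.exists_equiv p
    have h1 := (hφ (u q)).eq_iff p q
    rw [Function.update_self, Function.update_self, Function.update_of_ne hpq.symm,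
      Function.update_of_ne hpq.symm] at h1
    have h2 := hφ (u q)
    rwa [h1.mp rfl] at h2

/-- Induction on the number of values that `τ` misses. If `τ p = τ q` and `c` is missed, sending `p`
to `c` instead enlarges the image; copying pebble `q` onto `p` then recovers `τ`. Permutations are
the base. -/
theorem comp (h : WLSim G₁ G₂ u u') (τ : Fin k → Fin k) : WLSim G₁ G₂ (u ∘ τ) (u' ∘ τ) := by
  classical
  induction hm : k - (Finset.univ.image τ).card using Nat.strong_induction_on generalizing τ with
  | _ m ih =>
  by_cases hτ : Function.Injective τ
  · exact fun t => wlColor_comp_perm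
      (Equiv.ofBijective τ (Finite.injective_iff_bijective.mp hτ)) t (h t)
  · obtain ⟨p, q, hpq, hne⟩ : ∃ p q, τ p = τ q ∧ p ≠ q := by
      simpa [Function.Injective] using hτ
    obtain ⟨c, hc⟩ : ∃ c, ∀ i, τ i ≠ c := by
      simpa [Function.Surjective] using mt Finite.injective_iff_surjective.mpr hτ
    have hle : ∀ τ' : Fin k → Fin k, (Finset.univ.image τ').card ≤ k := fun τ' =>
      Finset.card_image_le.trans (by simp)
    have hsub : insert c (Finset.univ.image τ) ⊆
        Finset.univ.image (Function.update τ p c) := by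
      intro x hx
      rw [Finset.mem_insert] at hx
      rw [Finset.mem_image]
      rcases hx with rfl | hx
      · exact ⟨p, Finset.mem_univ _, Function.update_self ..⟩
      · obtain ⟨i, -, rfl⟩ := Finset.mem_image.mp hx
        rcases eq_or_ne i p with rfl | hi
        · exact ⟨q, Finset.mem_univ _, by rw [Function.update_of_ne hne.symm, hpq]⟩
        · exact ⟨i, Finset.mem_univ _, Function.update_of_ne hi ..⟩
    have hlt := Finset.card_le_card hsub
    rw [Finset.card_insert_of_notMem (by simpa using hc)] at hlt
    have h1 := ih _ (by have := hle (Function.update τ p c); omega) (Function.update τ p c) rfl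
    have h2 := h1.update_apply p q
    have hu : ∀ v : Fin k → Fin n, Function.update (v ∘ Function.update τ p c) p
        ((v ∘ Function.update τ p c) q) = v ∘ τ := fun v => by
      funext i
      rcases eq_or_ne i p with rfl | hi
      · simp [Function.update_of_ne hne.symm, hpq]
      · simp [Function.update_of_ne hi]
    rwa [hu, hu] at h2

end WLSim

end WL

section Triples

variable {n d : ℕ} {G₁ G₂ : AttrGraph n d}

theorem WLSim.select {u u' : Fin 3 → Fin n} (h : WLSim G₁ G₂ u u') (p q r : Fin 3) :
    WLSim G₁ G₂ ![u p, u q, u r] ![u' p, u' q, u' r] := by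
  have hu : ∀ v : Fin 3 → Fin n, v ∘ ![p, q, r] = ![v p, v q, v r] := fun v => by
    funext i
    fin_cases i <;> rfl
  have h1 := h.comp ![p, q, r]
  rwa [hu, hu] at h1

/-- Throughout, the first two positions hold the nodes in use and the third is the spare pebble. -/
theorem WLSim.exists_equiv_last {a b c a' b' c' : Fin n}
    (h : WLSim G₁ G₂ ![a, b, c] ![a', b', c']) : ∃ φ : Fin n ≃ Fin n, ∀ w,
    WLSim G₁ G₂ ![a, b, w] ![a', b', φ w] := by
  obtain ⟨φ, hφ⟩ := h.exists_equiv 2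
  refine ⟨φ, fun w => ?_⟩
  have hu : ∀ x y z w : Fin n, Function.update ![x, y, z] 2 w = ![x, y, w] := fun x y z w => by
    funext i
    fin_cases i <;> rfl
  have h1 := hφ w
  rwa [hu, hu] at h1

end Triples

/-! Bags of subgraphs which 3-WL does not tell apart. -/

section Bags

variable {n d₀ : ℕ} {G₁ G₂ : AttrGraph n d₀}

/-- Triples of nodes which 3-WL does not tell apart look the same in the two bags. -/
structure BagSim {d : ℕ} (B₁ : Bag G₁ d) (B₂ : Bag G₂ d) : Prop where
  adj_iff : ∀ {a b c a' b' c' : Fin n}, WLSim G₁ G₂ ![a, b, c] ![a', b', c'] →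
    ((B₁ a).sub.Adj b c ↔ (B₂ a').sub.Adj b' c')
  mem_iff : ∀ {a b c a' b' c' : Fin n}, WLSim G₁ G₂ ![a, b, c] ![a', b', c'] →
    (b ∈ (B₁ a).sub.verts ↔ b' ∈ (B₂ a').sub.verts)
  feat_eq : ∀ {a b c a' b' c' : Fin n}, WLSim G₁ G₂ ![a, b, c] ![a', b', c'] →
    (B₁ a).feat b = (B₂ a').feat b'

/-! ### Selection policies -/

/-- The distance ball of radius `h + 1` around `v` in terms of balls of radius `h`. -/
theorem edist_le_succ_iff {V : Type*} (G : SimpleGraph V) (h : ℕ) (v w : V) :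
    G.edist v w ≤ ((h + 1 : ℕ) : ℕ∞) ↔
      ∃ x, (v = x ∨ G.Adj v x) ∧ G.edist x w ≤ (h : ℕ∞) := by
  constructor
  · intro hle
    obtain ⟨p, hp⟩ := G.exists_walk_of_edist_ne_top (ne_top_of_le_ne_top (by simp) hle)
    cases p with
    | nil => exact ⟨v, Or.inl rfl, by simp⟩
    | cons hadj q =>
      refine ⟨_, Or.inr hadj, (G.edist_le q).trans ?_⟩
      rw [← hp, SimpleGraph.Walk.length_cons, Nat.cast_le] at hle
      exact_mod_cast Nat.le_of_succ_le_succ hle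
  · rintro ⟨x, hx, hle⟩
    have h1 : G.edist v x ≤ 1 := G.edist_le_one_iff_adj_or_eq.mpr hx.symm
    calc G.edist v w ≤ G.edist v x + G.edist x w := G.edist_triangle
      _ ≤ 1 + h := add_le_add h1 hle
      _ = ((h + 1 : ℕ) : ℕ∞) := by push_cast; exact add_comm _ _

/-- The spare pebble picks the next node `x` of a path from `a` to `b`. From then on `x` replaces
`a`, whose pebble becomes the spare one. -/
theorem WLSim.edist_le_iff (h : ℕ) : ∀ {a b c a' b' c' : Fin n},
    WLSim G₁ G₂ ![a, b, c] ![a', b', c'] →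
      (G₁.graph.edist a b ≤ (h : ℕ∞) ↔ G₂.graph.edist a' b' ≤ (h : ℕ∞)) := by
  induction h with
  | zero =>
    intro a b c a' b' c' hs
    simpa using hs.eq_iff 0 1
  | succ h ih =>
    intro a b c a' b' c' hs
    obtain ⟨φ, hφ⟩ := hs.exists_equiv_last
    rw [edist_le_succ_iff, edist_le_succ_iff]
    refine φ.exists_congr fun x => ?_
    exact and_congr (or_congr ((hφ x).eq_iff 0 2) ((hφ x).adj_iff 0 2))
      (ih ((hφ x).select 2 1 0))

theorem WLSim.markedFeat_eq {a b c a' b' c' : Fin n}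
    (hs : WLSim G₁ G₂ ![a, b, c] ![a', b', c']) :
    markedFeat G₁ a b = markedFeat G₂ a' b' := by
  have h1 : G₁.feat b = G₂.feat b' := hs.feat_eq 1
  have h2 : b = a ↔ b' = a' := hs.eq_iff 1 0
  simp only [markedFeat, h1, h2]

theorem WLSim.egoNet_adj_iff (h : ℕ) {a b c a' b' c' : Fin n}
    (hs : WLSim G₁ G₂ ![a, b, c] ![a', b', c']) :
    (egoNet G₁ h a).Adj b c ↔ (egoNet G₂ h a').Adj b' c' := by
  simp only [egoNet, SimpleGraph.Subgraph.induce_adj, SimpleGraph.Subgraph.top_adj,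
    Set.mem_ofPred_eq]
  exact and_congr (hs.edist_le_iff h) (and_congr ((hs.select 0 2 1).edist_le_iff h)
    (hs.adj_iff 1 2))

/-- The known policies produce similar bags. -/
theorem KnownPolicy.bagSim {d₁ : ℕ} {π : NodePolicy d₀ d₁} (hπ : KnownPolicy d₀ π) :
    BagSim (π.bag G₁) (π.bag G₂) := by
  cases hπ with
  | nd =>
    refine ⟨fun {a b c a' b' c'} hs => ?_, fun {a b c a' b' c'} hs => ?_,
      fun hs => hs.feat_eq 1⟩
    · have h1 : b = a ↔ b' = a' := hs.eq_iff 1 0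
      have h2 : c = a ↔ c' = a' := hs.eq_iff 2 0
      have h3 : G₁.graph.Adj b c ↔ G₂.graph.Adj b' c' := hs.adj_iff 1 2
      simp [NodePolicy.bag, nodeDeletion, h1, h2, h3]
    · have h1 : b = a ↔ b' = a' := hs.eq_iff 1 0
      simp [NodePolicy.bag, nodeDeletion, h1]
  | nm =>
    exact ⟨fun hs => hs.adj_iff 1 2, fun _ => Iff.rfl, fun hs => hs.markedFeat_eq⟩
  | ego h hpos =>
    exact ⟨fun hs => hs.egoNet_adj_iff h, fun hs => hs.edist_le_iff h, fun hs => hs.feat_eq 1⟩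
  | egoPlus h hpos =>
    exact ⟨fun hs => hs.egoNet_adj_iff h, fun hs => hs.edist_le_iff h,
      fun hs => hs.markedFeat_eq⟩

/-! ### Invariance under ReIGN(2) layers -/

section Layer

variable {d d₁ : ℕ} {B₁ : Bag G₁ d} {B₂ : Bag G₂ d}

/-- Aggregations over similar scopes of similar terms agree. -/
theorem BagSim.sum_scope (hB : BagSim B₁ B₂) {k i c k' i' c' : Fin n}
    (hs : WLSim G₁ G₂ ![k, i, c] ![k', i', c']) (s : Locality) {e e' : Finset (Fin n)}
    (he : ∀ {j j'}, WLSim G₁ G₂ ![k, i, j] ![k', i', j'] → (j ∈ e ↔ j' ∈ e'))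
    {f f' : Fin n → Fin d → ℝ}
    (hf : ∀ {j j'}, WLSim G₁ G₂ ![k, i, j] ![k', i', j'] → f j = f' j') :
    ∑ j ∈ scope B₁ k i e s, f j = ∑ j ∈ scope B₂ k' i' e' s, f' j := by
  obtain ⟨φ, hφ⟩ := hs.exists_equiv_last
  refine Finset.sum_equiv φ (fun j => ?_) fun j _ => hf (hφ j)
  cases s with
  | all => simp [scope, he (hφ j)]
  | sub => simpa [scope] using hB.adj_iff (hφ j)
  | orig => simpa [scope] using (hφ j).adj_iff 1 2

theorem WLSim.mem_singleton_node {k i j k' i' j' : Fin n}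
    (hs : WLSim G₁ G₂ ![k, i, j] ![k', i', j']) :
    j ∈ ({i} : Finset (Fin n)) ↔ j' ∈ ({i'} : Finset (Fin n)) := by
  simpa using hs.eq_iff 2 1

theorem WLSim.mem_singleton_root {k i j k' i' j' : Fin n}
    (hs : WLSim G₁ G₂ ![k, i, j] ![k', i', j']) :
    j ∈ ({k} : Finset (Fin n)) ↔ j' ∈ ({k'} : Finset (Fin n)) := by
  simpa using hs.eq_iff 2 0

theorem BagSim.onUpdate_eq (hB : BagSim B₁ B₂) (L : ReIGNLayer d d₁) {i i' : Fin n}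
    (hs : WLSim G₁ G₂ ![i, i, i] ![i', i', i']) : L.onUpdate B₁ i = L.onUpdate B₂ i' := by
  have h0 : (B₁ i).feat i = (B₂ i').feat i' := hB.feat_eq hs
  have h1 : ∀ s, ∑ j ∈ scope B₁ i i ∅ s, (B₁ j).feat j
      = ∑ j ∈ scope B₂ i' i' ∅ s, (B₂ j).feat j := fun s =>
    hB.sum_scope hs s (fun _ => by simp) fun h => hB.feat_eq (h.select 2 2 2)
  have h2 : ∀ s, ∑ j ∈ scope B₁ i i {i} s, (B₁ i).feat j
      = ∑ j ∈ scope B₂ i' i' {i'} s, (B₂ i').feat j := fun s =>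
    hB.sum_scope hs s (fun h => h.mem_singleton_node) fun h => hB.feat_eq (h.select 0 2 2)
  have h3 : ∀ s, ∑ h ∈ scope B₁ i i {i} s, (B₁ h).feat i
      = ∑ h ∈ scope B₂ i' i' {i'} s, (B₂ h).feat i' := fun s =>
    hB.sum_scope hs s (fun h => h.mem_singleton_node) fun h => hB.feat_eq (h.select 2 0 0)
  -- The inner sum depends on `h` alone, so `i` is forgotten and `h` occupies all three positions.
  have h4 : ∀ s r, ∑ h ∈ scope B₁ i i ∅ s, ∑ j ∈ scope B₁ h h {h} r, (B₁ h).feat j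
      = ∑ h ∈ scope B₂ i' i' ∅ s, ∑ j ∈ scope B₂ h h {h} r, (B₂ h).feat j := fun s r =>
    hB.sum_scope hs s (fun _ => by simp) fun h =>
      hB.sum_scope (h.select 2 2 2) r (fun h => h.mem_singleton_node)
        fun h => hB.feat_eq (h.select 0 2 2)
  simp only [ReIGNLayer.onUpdate, h0, h1, h2, h3, h4]

/-- The critical term is the double sum, which involves `k`, `i`, `h`, `j`. Only the range of `h`
involves `k`; once `h` is placed, `k` is dropped and the inner sum is played on `(h, i, j)`. -/
theorem BagSim.offUpdate_eq (hB : BagSim B₁ B₂) (L : ReIGNLayer d d₁) {k i c k' i' c' : Fin n}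
    (hs : WLSim G₁ G₂ ![k, i, c] ![k', i', c']) :
    L.offUpdate B₁ k i = L.offUpdate B₂ k' i' := by
  have h0 : (B₁ k).feat i = (B₂ k').feat i' := hB.feat_eq hs
  have h0' : (B₁ i).feat k = (B₂ i').feat k' := hB.feat_eq (hs.select 1 0 0)
  have h1 : ∀ s r, ∑ h ∈ scope B₁ k i ∅ s, ∑ j ∈ scope B₁ h i {h} r, (B₁ h).feat j
      = ∑ h ∈ scope B₂ k' i' ∅ s, ∑ j ∈ scope B₂ h i' {h} r, (B₂ h).feat j := fun s r =>
    hB.sum_scope hs s (fun _ => by simp) fun h =>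
      hB.sum_scope (h.select 2 1 1) r (fun h => h.mem_singleton_root)
        fun h => hB.feat_eq (h.select 0 2 2)
  have h2 : ∀ s, ∑ h ∈ scope B₁ k i {i} s, (B₁ h).feat i
      = ∑ h ∈ scope B₂ k' i' {i'} s, (B₂ h).feat i' := fun s =>
    hB.sum_scope hs s (fun h => h.mem_singleton_node) fun h => hB.feat_eq (h.select 2 1 1)
  have h3 : ∀ s, ∑ j ∈ scope B₁ k i {k} s, (B₁ k).feat j
      = ∑ j ∈ scope B₂ k' i' {k'} s, (B₂ k').feat j := fun s =>
    hB.sum_scope hs s (fun h => h.mem_singleton_root) fun h => hB.feat_eq (h.select 0 2 2)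
  have h4 : ∀ s, ∑ h ∈ scope B₁ k i {i} s, (B₁ i).feat h
      = ∑ h ∈ scope B₂ k' i' {i'} s, (B₂ i').feat h := fun s =>
    hB.sum_scope hs s (fun h => h.mem_singleton_node) fun h => hB.feat_eq (h.select 1 2 2)
  have h5 : ∀ s, ∑ h ∈ scope B₁ k i {k} s, (B₁ h).feat k
      = ∑ h ∈ scope B₂ k' i' {k'} s, (B₂ h).feat k' := fun s =>
    hB.sum_scope hs s (fun h => h.mem_singleton_root) fun h => hB.feat_eq (h.select 2 0 0)
  have h6 : ∀ s, ∑ j ∈ scope B₁ k i ∅ s, (B₁ j).feat j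
      = ∑ j ∈ scope B₂ k' i' ∅ s, (B₂ j).feat j := fun s =>
    hB.sum_scope hs s (fun _ => by simp) fun h => hB.feat_eq (h.select 2 2 2)
  have h7 : (B₁ k).feat k = (B₂ k').feat k' := hB.feat_eq (hs.select 0 0 0)
  have h8 : (B₁ i).feat i = (B₂ i').feat i' := hB.feat_eq (hs.select 1 1 1)
  simp only [ReIGNLayer.offUpdate, h0, h0', h1, h2, h3, h4, h5, h6, h7, h8]

theorem BagSim.apply (hB : BagSim B₁ B₂) (L : ReIGNLayer d d₁) :
    BagSim (L.apply B₁) (L.apply B₂) where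
  adj_iff hs := hB.adj_iff hs
  mem_iff hs := hB.mem_iff hs
  feat_eq {a b c a' b' c'} hs := by
    have hab : b = a ↔ b' = a' := hs.eq_iff 1 0
    have hon : L.onUpdate B₁ b = L.onUpdate B₂ b' := hB.onUpdate_eq L (hs.select 1 1 1)
    simp only [ReIGNLayer.apply, hab, hon, hB.offUpdate_eq L hs]

theorem BagSim.mapFeat (hB : BagSim B₁ B₂) (σ : ℝ → ℝ) :
    BagSim (B₁.mapFeat σ) (B₂.mapFeat σ) where
  adj_iff hs := hB.adj_iff hs
  mem_iff hs := hB.mem_iff hs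
  feat_eq hs := by simp only [Bag.mapFeat, hB.feat_eq hs]

end Layer

theorem BagSim.eval {d d₁ : ℕ} (S : ReIGNStack d d₁) : ∀ {B₁ : Bag G₁ d} {B₂ : Bag G₂ d},
    BagSim B₁ B₂ → BagSim (S.eval B₁) (S.eval B₂) := by
  induction S with
  | last L => exact fun hB => hB.apply L
  | cons L σ rest ih => exact fun hB => ih ((hB.apply L).mapFeat σ)

end Bags

/-! Invariant graph networks on tensors which 3-WL does not tell apart. -/

section IGN

variable {n d₀ : ℕ} {G₁ G₂ : AttrGraph n d₀}

/-- Two functions of `k`-tuples agree on tuples selected from similar triples. -/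
def TupleSim (G₁ G₂ : AttrGraph n d₀) {k : ℕ} {α : Type*} (Y₁ Y₂ : (Fin k → Fin n) → α) : Prop :=
  ∀ ⦃u u' : Fin 3 → Fin n⦄, WLSim G₁ G₂ u u' → ∀ τ : Fin k → Fin 3, Y₁ (u ∘ τ) = Y₂ (u' ∘ τ)

theorem WLSim.ker_eq {u u' : Fin 3 → Fin n} (hs : WLSim G₁ G₂ u u') {k : ℕ}
    (τ : Fin k → Fin 3) : Setoid.ker (u ∘ τ) = Setoid.ker (u' ∘ τ) :=
  Setoid.ext fun i j => hs.eq_iff (τ i) (τ j)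

/-- The pairs of positions at which the tuples `a` and `b` have a common entry. -/
def commonEntries {k k₁ : ℕ} (a : Fin k → Fin n) (b : Fin k₁ → Fin n) : Finset (Fin k × Fin k₁) :=
  Finset.univ.filter fun x => a x.1 = b x.2

/-! ### Sums over tuples with prescribed coincidences -/

section Sums

variable {M : Type*} [AddCommGroup M] {k k₁ : ℕ}

/-- Sums over the tuples which extend a given partial tuple agree. -/
theorem TupleSim.sum_extensions {Z₁ Z₂ : (Fin k → Fin n) → M} (hZ : TupleSim G₁ G₂ Z₁ Z₂)
    (ι : Fin k ↪ Fin 3) (J : Finset (Fin k)) : ∀ {v v' : Fin 3 → Fin n}, WLSim G₁ G₂ v v' →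
    ∑ a with ∀ i ∉ J, a i = v (ι i), Z₁ a = ∑ a with ∀ i ∉ J, a i = v' (ι i), Z₂ a := by
  induction J using Finset.induction_on with
  | empty =>
    intro v v' hs
    have hu : ∀ x : Fin 3 → Fin n,
        (Finset.univ.filter fun a : Fin k → Fin n => ∀ i ∉ (∅ : Finset (Fin k)), a i = x (ι i))
          = {x ∘ ι} := fun x => by
      ext a
      simp [funext_iff]
    rw [hu, hu, Finset.sum_singleton, Finset.sum_singleton]
    exact hZ hs ι
  | insert p J hp ih =>
    intro v v' hs
    -- The sum over the free coordinate `p` is a pebble move at `ι p`. Since `ι` is injective, the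
    -- positions of the fixed coordinates are untouched.
    obtain ⟨φ, hφ⟩ := hs.exists_equiv (ι p)
    have hu : ∀ (x : Fin 3 → Fin n) (w : Fin n),
        ((Finset.univ.filter fun a : Fin k → Fin n => ∀ i ∉ insert p J, a i = x (ι i)).filter
          fun a => a p = w) =
        Finset.univ.filter fun a : Fin k → Fin n =>
          ∀ i ∉ J, a i = Function.update x (ι p) w (ι i) := fun x w => by
      ext a
      simp only [Finset.mem_filter, Finset.mem_univ, true_and, Finset.mem_insert, not_or]
      constructor
      · rintro ⟨h1, h2⟩ i hi
        rcases eq_or_ne i p with rfl | hip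
        · rw [Function.update_self, h2]
        · rw [Function.update_of_ne (ι.injective.ne hip), h1 i ⟨hip, hi⟩]
      · intro h
        refine ⟨fun i hi => ?_, by simpa using h p hp⟩
        rw [h i hi.2, Function.update_of_ne (ι.injective.ne hi.1)]
    rw [← Finset.sum_fiberwise _ (fun a => a p) Z₁, ← Finset.sum_fiberwise _ (fun a => a p) Z₂]
    refine Fintype.sum_equiv φ _ _ fun w => ?_
    rw [hu, hu]
    exact ih (hφ w)

/-- Sums over the tuples with at least the given matches agree. -/
theorem TupleSim.sum_commonEntries_ge (hk : k ≤ 3) {Z₁ Z₂ : (Fin k → Fin n) → M}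
    (hZ : TupleSim G₁ G₂ Z₁ Z₂) {u u' : Fin 3 → Fin n} (hs : WLSim G₁ G₂ u u')
    (τ : Fin k₁ → Fin 3) (m : Finset (Fin k × Fin k₁)) :
    ∑ a with m ⊆ commonEntries a (u ∘ τ), Z₁ a = ∑ a with m ⊆ commonEntries a (u' ∘ τ), Z₂ a := by
  classical
  -- If `m` forces two values on one coordinate, both sums are empty; similarity makes this the case
  -- for `u` and `u'` alike.
  by_cases hm : ∀ i j j', (i, j) ∈ m → (i, j') ∈ m → u (τ j) = u (τ j')
  · have hm' : ∀ i j j', (i, j) ∈ m → (i, j') ∈ m → u' (τ j) = u' (τ j') :=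
      fun i j j' h h' => (hs.eq_iff _ _).mp (hm i j j' h h')
    let ι : Fin k ↪ Fin 3 := Fin.castLEEmb hk
    let J : Finset (Fin k) := Finset.univ.filter fun i => ∀ j, (i, j) ∉ m
    -- Pebbles are copied so that position `ι i` holds the value that `m` forces on coordinate `i`.
    -- The values of `g` on `J`, and of `g'` off the range of `ι`, are immaterial.
    let g : Fin k → Fin 3 := fun i => if h : ∃ j, (i, j) ∈ m then τ h.choose else ι i
    let g' : Fin 3 → Fin 3 := Function.extend ι g id
    have hu : ∀ x : Fin 3 → Fin n,
        (∀ i j j', (i, j) ∈ m → (i, j') ∈ m → x (τ j) = x (τ j')) →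
        (Finset.univ.filter fun a : Fin k → Fin n => m ⊆ commonEntries a (x ∘ τ)) =
          Finset.univ.filter fun a : Fin k → Fin n => ∀ i ∉ J, a i = (x ∘ g') (ι i) := by
      intro x hx
      ext a
      simp only [Finset.mem_filter, Finset.mem_univ, true_and, commonEntries, Finset.subset_iff,
        Function.comp_apply, J, not_forall, not_not, g', ι.injective.extend_apply, Prod.forall]
      constructor
      · intro h i hi
        simp only [g, dif_pos hi]
        exact h i _ hi.choose_spec
      · intro h i j hij
        have hi : ∃ j, (i, j) ∈ m := ⟨j, hij⟩
        rw [h i hi]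
        simp only [g, dif_pos hi]
        exact hx i _ _ hi.choose_spec hij
    rw [hu u hm, hu u' hm']
    exact hZ.sum_extensions ι J (hs.comp g')
  · have hu : ∀ x : Fin 3 → Fin n,
        ¬ (∀ i j j', (i, j) ∈ m → (i, j') ∈ m → x (τ j) = x (τ j')) →
        (Finset.univ.filter fun a : Fin k → Fin n => m ⊆ commonEntries a (x ∘ τ)) = ∅ := by
      intro x hx
      refine Finset.filter_eq_empty_iff.mpr fun a _ h => hx fun i j j' hj hj' => ?_
      have h1 := h hj
      have h2 := h hj'
      simp only [commonEntries, Finset.mem_filter, Finset.mem_univ, true_and,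
        Function.comp_apply] at h1 h2
      rw [← h1, ← h2]
    rw [hu u hm, hu u' fun h => hm fun i j j' hj hj' => (hs.eq_iff _ _).mpr (h i j j' hj hj')]
    rfl

/-- Sums over the tuples with exactly the given matches agree. -/
theorem TupleSim.sum_commonEntries_eq (hk : k ≤ 3) {Z₁ Z₂ : (Fin k → Fin n) → M}
    (hZ : TupleSim G₁ G₂ Z₁ Z₂) {u u' : Fin 3 → Fin n} (hs : WLSim G₁ G₂ u u')
    (τ : Fin k₁ → Fin 3) (m : Finset (Fin k × Fin k₁)) :
    ∑ a with commonEntries a (u ∘ τ) = m, Z₁ a = ∑ a with commonEntries a (u' ∘ τ) = m, Z₂ a := by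
  classical
  -- Downward induction: having at least the matches `m` means having exactly `m` or exactly some
  -- strictly larger set, and the larger sets cancel.
  induction m using WellFoundedGT.induction with
  | ind m ih =>
  have hsplit : ∀ (Z : (Fin k → Fin n) → M) (x : Fin 3 → Fin n),
      ∑ a with m ⊆ commonEntries a (x ∘ τ), Z a =
        ∑ a with commonEntries a (x ∘ τ) = m, Z a +
          ∑ s with m ⊂ s, ∑ a with commonEntries a (x ∘ τ) = s, Z a := by
    intro Z x
    have hins : (Finset.univ.filter fun s => m ⊆ s) =
        insert m (Finset.univ.filter fun s => m ⊂ s) := by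
      ext s
      simp [subset_iff_ssubset_or_eq, or_comm, eq_comm]
    rw [← Finset.sum_insert (s := Finset.univ.filter fun s => m ⊂ s) (a := m)
      (f := fun s => ∑ a with commonEntries a (x ∘ τ) = s, Z a) (by simp), ← hins,
      ← Finset.sum_fiberwise_of_maps_to
      (g := fun a => commonEntries a (x ∘ τ)) (t := Finset.univ.filter fun s => m ⊆ s)
      (fun a ha => by simpa using ha)]
    refine Finset.sum_congr rfl fun s hs => Finset.sum_congr ?_ fun _ _ => rfl
    rw [Finset.filter_filter]
    refine Finset.filter_congr fun a _ => and_iff_right_of_imp fun h => ?_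
    rw [h]
    exact (Finset.mem_filter.mp hs).2
  have h := hZ.sum_commonEntries_ge hk hs τ m
  rw [hsplit, hsplit, Finset.sum_congr rfl fun s hs => ih s
    (Finset.mem_filter.mp hs).2] at h
  exact add_right_cancel h

end Sums

/-- Equivariant layers preserve similarity of tensors. -/
theorem TupleSim.apply {k k₁ d d₁ : ℕ} (hk : k ≤ 3) (L : IGNLayer k k₁ d d₁)
    {Y₁ Y₂ : Tensor n k d} (hY : TupleSim G₁ G₂ Y₁ Y₂) :
    TupleSim G₁ G₂ (L.apply Y₁) (L.apply Y₂) := by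
  intro u u' hs τ
  let pat : (Fin k → Fin n) × (Fin k₁ → Fin n) →
      Setoid (Fin k) × Setoid (Fin k₁) × Finset (Fin k × Fin k₁) :=
    fun x => (Setoid.ker x.1, Setoid.ker x.2, commonEntries x.1 x.2)
  have hfac : Function.FactorsThrough
      (fun x : (Fin k → Fin n) × (Fin k₁ → Fin n) => Setoid.ker (Sum.elim x.1 x.2)) pat := by
    rintro ⟨a, b⟩ ⟨a', b'⟩ h
    simp only [pat, Prod.mk.injEq] at h
    obtain ⟨h1, h2, h3⟩ := h
    have hm : ∀ i j, a i = b j ↔ a' i = b' j := fun i j => by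
      simpa [commonEntries] using Finset.ext_iff.mp h3 (i, j)
    refine Setoid.ext fun p q => ?_
    rcases p with i | i <;> rcases q with j | j
    · exact Setoid.ext_iff.mp h1 i j
    · exact hm i j
    · exact eq_comm.trans ((hm j i).trans eq_comm)
    · exact Setoid.ext_iff.mp h2 i j
  -- The joint equality pattern is a function of the two separate patterns and the coincidences; the
  -- default `⊥` is never reached.
  obtain ⟨w, hw⟩ : ∃ w, ∀ (a : Fin k → Fin n) (b : Fin k₁ → Fin n),
      Setoid.ker (Sum.elim a b) = w (Setoid.ker a, Setoid.ker b, commonEntries a b) :=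
    ⟨Function.extend pat (fun x => Setoid.ker (Sum.elim x.1 x.2)) fun _ => ⊥,
      fun a b => (hfac.extend_apply _ (a, b)).symm⟩
  simp only [IGNLayer.apply, hw, hs.ker_eq τ]
  congr 1
  rw [← Finset.sum_fiberwise _ (fun a => commonEntries a (u ∘ τ)),
    ← Finset.sum_fiberwise _ (fun a => commonEntries a (u' ∘ τ))]
  refine Finset.sum_congr rfl fun m _ => ?_
  -- With the coincidences fixed to `m`, the weight depends on `a` only through its own equality
  -- pattern, so the weighted summand again respects similarity.
  have hZ : TupleSim G₁ G₂
      (fun a => (L.weight (w (Setoid.ker a, Setoid.ker (u' ∘ τ), m))).mulVec (Y₁ a))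
      (fun a => (L.weight (w (Setoid.ker a, Setoid.ker (u' ∘ τ), m))).mulVec (Y₂ a)) := by
    intro v v' hv τ'
    simp only [hv.ker_eq τ', hY hv τ']
  refine Eq.trans (Finset.sum_congr rfl fun a ha => ?_)
    ((hZ.sum_commonEntries_eq hk hs τ m).trans (Finset.sum_congr rfl fun a ha => ?_))
  · rw [(Finset.mem_filter.mp ha).2]
  · rw [(Finset.mem_filter.mp ha).2]

theorem IGNStack.order_le {k d k₁ d₁ : ℕ} (S : IGNStack k d k₁ d₁) : k₁ ≤ 3 := by
  induction S with
  | last hk hk₁ L => exact hk₁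
  | cons hk L rest ih => exact ih

theorem TupleSim.eval {k d k₁ d₁ : ℕ} (S : IGNStack k d k₁ d₁) : ∀ {Y₁ Y₂ : Tensor n k d},
    TupleSim G₁ G₂ Y₁ Y₂ → TupleSim G₁ G₂ (S.eval Y₁) (S.eval Y₂) := by
  induction S with
  | last hk hk₁ L => exact fun hY => hY.apply hk L
  | cons hk L rest ih =>
    intro Y₁ Y₂ hY
    refine ih fun u u' hs τ => ?_
    rw [hY.apply hk L hs τ]

/-- A 3-IGN does not tell similar tensors apart. -/
theorem IGN3.eval_eq {d out : ℕ} (M : IGN3 d out) {Y₁ Y₂ : Tensor n 3 d}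
    (hY : TupleSim G₁ G₂ Y₁ Y₂) {u u' : Fin 3 → Fin n} (hs : WLSim G₁ G₂ u u') :
    M.eval Y₁ = M.eval Y₂ := by
  have h := (TupleSim.eval M.stack hY).apply M.stack.order_le M.pool hs Fin.elim0
  rw [Subsingleton.elim (u ∘ Fin.elim0) Fin.elim0,
    Subsingleton.elim (u' ∘ Fin.elim0) Fin.elim0] at h
  rw [IGN3.eval, IGN3.eval, h]

/-- Similar bags give similar tensors. -/
theorem BagSim.tupleSim_bagTensor {d : ℕ} {B₁ : Bag G₁ d} {B₂ : Bag G₂ d} (hB : BagSim B₁ B₂) :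
    TupleSim G₁ G₂ (bagTensor G₁ B₁) (bagTensor G₂ B₂) := by
  intro u u' hs τ
  have h : WLSim G₁ G₂ ![(u ∘ τ) 0, (u ∘ τ) 1, (u ∘ τ) 2]
      ![(u' ∘ τ) 0, (u' ∘ τ) 1, (u' ∘ τ) 2] := hs.select (τ 0) (τ 1) (τ 2)
  have hadj : G₁.graph.Adj ((u ∘ τ) 1) ((u ∘ τ) 2) ↔ G₂.graph.Adj ((u' ∘ τ) 1) ((u' ∘ τ) 2) :=
    h.adj_iff 1 2
  have heq : (u ∘ τ) 1 = (u ∘ τ) 2 ↔ (u' ∘ τ) 1 = (u' ∘ τ) 2 := h.eq_iff 1 2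
  have hfeat : G₁.feat ((u ∘ τ) 1) = G₂.feat ((u' ∘ τ) 1) := h.feat_eq 1
  simp only [bagTensor]
  congr 1
  · rw [propext (hB.adj_iff h), propext (hB.mem_iff h), propext hadj]
    congr! 4
    exact and_congr_left' heq
  · simp only [hB.feat_eq h, hfeat, heq]

/-- Graphs with the same histograms of triples have a pair of similar triples. -/
theorem exists_wlSim_of_not_distinguishes [NeZero n] (h : ¬ WLDistinguishes 3 G₁ G₂) :
    ∃ u u' : Fin 3 → Fin n, WLSim G₁ G₂ u u' := by
  by_contra hne
  simp only [WLSim, not_exists, not_forall] at hne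
  simp only [WLDistinguishes, not_exists, not_not] at h
  -- One fixed triple suffices: if each of the finitely many candidates is separated from it in some
  -- round, the histograms at the largest of these rounds still provide a partner.
  choose t ht using hne 0
  obtain ⟨φ, hφ⟩ := exists_equiv_of_map_univ_eq (h (Finset.univ.sup t))
  exact ht (φ 0) (wlColor_eq_of_le (Finset.le_sup (f := t) (Finset.mem_univ (φ 0))) (hφ 0).symm)

/-- A histogram counts all `n ^ 3` triples, and cubing is injective. -/
theorem card_eq_of_not_distinguishes {n₁ n₂ : ℕ} {H₁ : AttrGraph n₁ d₀} {H₂ : AttrGraph n₂ d₀}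
    (h : ¬ WLDistinguishes 3 H₁ H₂) : n₁ = n₂ := by
  simp only [WLDistinguishes, not_exists, not_not] at h
  have h1 := congrArg Multiset.card (h 0)
  simp only [wlHistogram, Multiset.card_map, Finset.card_val, Finset.card_univ, Fintype.card_fun,
    Fintype.card_fin] at h1
  exact Nat.pow_left_injective (n := 3) (by norm_num) h1

/-- Without nodes there is no triple to start the game from; this settles that case. -/
instance : Subsingleton (AttrGraph 0 d₀) where
  allEq := fun ⟨g, x⟩ ⟨g', x'⟩ => by
    rw [Subsingleton.elim g g', Subsingleton.elim x x']

end IGN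

end SubgraphGNN

theorem corollary2 {d d₁ d₂ e out : ℕ}
    (π : NodePolicy d d₁) (hπ : KnownPolicy d π)
    (S : ReIGNStack d₁ d₂)
    (ρ : Pooling d d₂ e) (hρ : IsIGN3Computable ρ)
    (act : ℝ → ℝ) (μ : MLP e out)
    {n₁ n₂ : ℕ} (G₁ : AttrGraph n₁ d) (G₂ : AttrGraph n₂ d)
    (hdist : reignModel π S ρ act μ G₁ ≠ reignModel π S ρ act μ G₂) :
    WLDistinguishes 3 G₁ G₂ := by
  by_contra h
  obtain rfl := card_eq_of_not_distinguishes h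
  refine hdist ?_
  rcases Nat.eq_zero_or_pos n₁ with rfl | hpos
  · rw [Subsingleton.elim G₁ G₂]
  · have : NeZero n₁ := ⟨hpos.ne'⟩
    obtain ⟨u, u', hs⟩ := exists_wlSim_of_not_distinguishes h
    have hB : BagSim (S.eval (π.bag G₁)) (S.eval (π.bag G₂)) := BagSim.eval S hπ.bagSim
    obtain ⟨M, hM₁, hM₂⟩ := hρ G₁ (S.eval (π.bag G₁)) G₂ (S.eval (π.bag G₂))
    rw [IGN3.ImplementsAt] at hM₁ hM₂
    rw [reignModel, reignModel, ← hM₁, ← hM₂, M.eval_eq hB.tupleSim_bagTensor hs]
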